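/- Let $B\le M(n,\mathbb{C})$ be a matrix Lie algebra, that is, a complex linear subspace of the $n\times n$ complex matrices that is closed under the commutator $[X,Y]=XY-YX$. Let $A\le B$ be any Cartan subalgebra of $B$, that is, a nilpotent Lie subalgebra of $B$ that equals its own normalizer $\{X\in B : [X,A]\subseteq A\}$ in $B$. For a linear subspace $V\le M(n,\mathbb{C})$ let $\mathrm{mrk}(V)=\max\{\mathrm{rank}(M) : M\in V\}$ denote its maximum rank. Then $\mathrm{mrk}(B)=\mathrm{mrk}(A)$. -/

import Mathlib

-- Square matrices carry the commutator bracket `⁅X, Y⁆ = X * Y - Y * X`.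
attribute [local instance 100] LieRing.ofAssociativeRing

/-- The maximum rank `mrk(V)` over all matrices in a matrix space `V ≤ M(n, 𝔽)`.
The set of ranks is nonempty and bounded above by `n`, so the supremum is a maximum
(see `mrk_isGreatest`). -/
noncomputable def mrk {𝕜 : Type*} [Field 𝕜] {n : ℕ}
    (V : Submodule 𝕜 (Matrix (Fin n) (Fin n) 𝕜)) : ℕ :=
  sSup {r : ℕ | ∃ M ∈ V, M.rank = r}

theorem mrk_isGreatest {𝕜 : Type*} [Field 𝕜] {n : ℕ}
    (V : Submodule 𝕜 (Matrix (Fin n) (Fin n) 𝕜)) :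
    IsGreatest {r : ℕ | ∃ M ∈ V, M.rank = r} (mrk V) := by
  have hbdd : BddAbove {r : ℕ | ∃ M ∈ V, M.rank = r} := by
    refine ⟨n, ?_⟩
    rintro r ⟨M, -, rfl⟩
    simpa using M.rank_le_card_width
  exact ⟨Nat.sSup_mem ⟨_, 0, V.zero_mem, rfl⟩ hbdd, fun r hr => le_csSup hbdd hr⟩

/-! Conjugation preserves rank, so it suffices to conjugate some matrix of maximal rank in `B` into
`A`. Choose `h` in `A` on which no nonzero root vanishes; then `A` and `[B, h]` span `B`. Hence `(a,
x) ↦ exp x * a * exp (-x)`, from `A × B` to `B`, is a submersion at `(h, 0)`, and conjugates of `A`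
fill a neighbourhood of `h` in `B` (`eventually_exists_units_conj_eq`). Maximal rank is generic on
the line from `h` to a maximizer (`Matrix.finite_rank_lineMap_lt`), so it occurs in that
neighbourhood. -/

/-- Conjugation by `exp x` preserves every closed subspace that `ad x` preserves. -/
theorem exp_mul_mul_exp_neg_mem {𝔸 : Type*} [NormedRing 𝔸] [NormedAlgebra ℂ 𝔸] [CompleteSpace 𝔸]
    (S : Submodule ℂ 𝔸) (hS : IsClosed (S : Set 𝔸)) {x : 𝔸}
    (hx : ∀ y ∈ S, x * y - y * x ∈ S) {y : 𝔸} (hy : y ∈ S) :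
    NormedSpace.exp x * y * NormedSpace.exp (-x) ∈ S := by
  let _ : NormedAlgebra ℚ 𝔸 := .restrictScalars ℚ ℂ 𝔸
  let _ : NormedAlgebra ℚ (𝔸 →L[ℂ] 𝔸) := .restrictScalars ℚ ℂ _
  let L : 𝔸 →+* (𝔸 →L[ℂ] 𝔸) :=
    { toFun := fun a => ContinuousLinearMap.mul ℂ 𝔸 a
      map_one' := by ext; simp
      map_mul' := fun a b => by ext; simp [mul_assoc]
      map_zero' := by simp
      map_add' := fun a b => by simp }
  let R : 𝔸ᵐᵒᵖ →+* (𝔸 →L[ℂ] 𝔸) :=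
    { toFun := fun a => (ContinuousLinearMap.mul ℂ 𝔸).flip a.unop
      map_one' := by ext; simp
      map_mul' := fun a b => by ext; simp [mul_assoc]
      map_zero' := by simp
      map_add' := fun a b => by simp }
  have hL : Continuous L := (ContinuousLinearMap.mul ℂ 𝔸).continuous
  have hR : Continuous R :=
    (ContinuousLinearMap.mul ℂ 𝔸).flip.continuous.comp MulOpposite.continuous_unop
  -- `L x + R (.op (-x))` is `ad x`; its exponential is conjugation because left and right
  -- multiplications commute.
  have hcomm : Commute (L x) (R (.op (-x))) := by
    ext z
    simp [L, R, mul_assoc]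
  have hexp : NormedSpace.exp (L x + R (.op (-x))) y
      = NormedSpace.exp x * y * NormedSpace.exp (-x) := by
    rw [NormedSpace.exp_add_of_commute hcomm, ← NormedSpace.map_exp L hL,
      ← NormedSpace.map_exp R hR, NormedSpace.exp_op]
    simp [L, R, mul_assoc]
  rw [← hexp]
  have hpow : ∀ k : ℕ, ((L x + R (.op (-x))) ^ k) y ∈ S := by
    intro k
    induction k with
    | zero => simpa using hy
    | succ k ih =>
      rw [pow_succ']
      simpa [L, R, sub_eq_add_neg] using hx _ ih
  have hsum := (NormedSpace.exp_series_hasSum_exp' (𝕂 := ℂ) (L x + R (.op (-x)))).mapL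
    (ContinuousLinearMap.apply ℂ 𝔸 y)
  refine hS.mem_of_tendsto hsum (Filter.Eventually.of_forall fun s => ?_)
  exact S.sum_mem fun k _ => S.smul_mem _ (hpow k)

/-- A matrix of rank `r` has an `r × r` compression equal to the identity. -/
theorem Matrix.exists_mul_mul_eq_one {K : Type*} [Field K] {m n : Type*} [Fintype m] [Fintype n]
    [DecidableEq m] [DecidableEq n] (M : Matrix m n K) :
    ∃ (P : Matrix (Fin M.rank) m K) (Q : Matrix n (Fin M.rank) K), P * M * Q = 1 := by
  let e : LinearMap.range M.mulVecLin ≃ₗ[K] (Fin M.rank → K) :=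
    LinearEquiv.ofFinrankEq _ _ (by
    rw [Module.finrank_fin_fun]; rfl)
  obtain ⟨p, hp⟩ := LinearMap.exists_extend e.toLinearMap
  have hsurj : LinearMap.range (p ∘ₗ M.toLin') = ⊤ := by
    rw [LinearMap.range_eq_top]
    intro y
    obtain ⟨x, hx⟩ := (e.symm y).2
    refine ⟨x, ?_⟩
    have h := LinearMap.congr_fun hp (e.symm y)
    simp only [LinearMap.comp_apply, Submodule.subtype_apply, LinearEquiv.coe_coe,
      LinearEquiv.apply_symm_apply] at h
    rw [LinearMap.comp_apply, Matrix.toLin'_apply', hx, h]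
  obtain ⟨q, hq⟩ := LinearMap.exists_rightInverse_of_surjective _ hsurj
  refine ⟨p.toMatrix', q.toMatrix', ?_⟩
  have := congrArg LinearMap.toMatrix' hq
  simpa [LinearMap.toMatrix'_comp] using this

/-- On the line through two matrices, the rank is generically at least the rank of each. -/
theorem Matrix.finite_rank_lineMap_lt {K : Type*} [Field K] {m n : Type*} [Fintype m] [Fintype n]
    [DecidableEq m] [DecidableEq n] (N M : Matrix m n K) :
    {t : K | (N + t • (M - N)).rank < M.rank}.Finite := by
  obtain ⟨P, Q, h⟩ := M.exists_mul_mul_eq_one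
  classical
  -- A nonzero minor-like polynomial in `t`: at `t = 1` it equals `det (P * M * Q) = 1`.
  let f : Polynomial K := (((P * N * Q).map Polynomial.C : Matrix _ _ (Polynomial K))
    + (Polynomial.X : Polynomial K) • (P * (M - N) * Q).map Polynomial.C).det
  have hf : ∀ t, f.eval t = (P * (N + t • (M - N)) * Q).det := by
    intro t
    rw [← Polynomial.coe_evalRingHom, RingHom.map_det]
    congr 1
    rw [Matrix.mul_add, Matrix.add_mul, Matrix.mul_smul, Matrix.smul_mul]
    ext i j
    simp [-Matrix.map_mul, mul_comm t]
  have hf0 : f ≠ 0 := by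
    intro h0
    have := hf 1
    simp [h0, h] at this
  refine (f.roots.toFinset.finite_toSet).subset fun t ht => ?_
  simp only [Finset.mem_coe, Multiset.mem_toFinset, Polynomial.mem_roots hf0, Polynomial.IsRoot, hf]
  by_contra hdet
  have hrank := Matrix.rank_of_isUnit (P * (N + t • (M - N)) * Q)
    ((Matrix.isUnit_iff_isUnit_det _).2 (Ne.isUnit hdet))
  have h1 := (Matrix.rank_mul_le_left (P * (N + t • (M - N))) Q).trans
    (Matrix.rank_mul_le_right P (N + t • (M - N)))
  rw [hrank, Fintype.card_fin] at h1
  exact absurd ht (not_lt.2 h1)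

/-- A generalized eigenspace for a nonzero eigenvalue lies in the range. -/
theorem Module.End.maxGenEigenspace_le_range {K V : Type*} [Field K] [AddCommGroup V] [Module K V]
    (f : Module.End K V) {c : K} (hc : c ≠ 0) :
    f.maxGenEigenspace c ≤ LinearMap.range f := by
  intro v hv
  obtain ⟨k, hk⟩ := Module.End.mem_maxGenEigenspace f c v |>.1 hv
  -- Bézout for `X` and `(X - c) ^ k`, evaluated at `f` and applied to `v`, writes `v` as `a(f) (f
  -- v)`.
  have hcop : IsCoprime (Polynomial.X : Polynomial K) ((Polynomial.X - Polynomial.C c) ^ k) := by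
    refine IsCoprime.pow_right ?_
    simpa using Polynomial.isCoprime_X_sub_C_of_isUnit_sub (R := K) (a := 0) (b := c)
      (by simpa using hc)
  obtain ⟨a, b, hab⟩ := hcop
  have := congrArg (fun p => Polynomial.aeval f p v) hab
  simp only [map_add, map_mul, map_pow, map_sub, Polynomial.aeval_X, Polynomial.aeval_C, map_one,
    LinearMap.add_apply, Module.End.mul_apply, Module.End.one_apply] at this
  have hk' : ((f - algebraMap K (Module.End K V) c) ^ k) v = 0 := hk
  rw [hk', map_zero, add_zero] at this
  refine ⟨Polynomial.aeval f a v, ?_⟩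
  have hcomm : Commute f (Polynomial.aeval f a) := by
    simpa using (Polynomial.commute_X a).map (Polynomial.aeval (R := K) f)
  rw [← Module.End.mul_apply, hcomm.eq, Module.End.mul_apply, this]

/-- A Cartan subalgebra contains an element `h` such that `A` and the range of `[·, h]` span. -/
theorem LieSubalgebra.IsCartanSubalgebra.exists_forall_eq_add_lie {K L : Type*} [Field K]
    [CharZero K] [IsAlgClosed K] [LieRing L] [LieAlgebra K L] [FiniteDimensional K L]
    (A : LieSubalgebra K L) [A.IsCartanSubalgebra] :
    ∃ h : A, ∀ b : L, ∃ a : A, ∃ x : L, a + ⁅x, (h : L)⁆ = b := by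
  -- Finitely many nonzero linear forms on `A` have a common nonvanishing point, as `K` is infinite.
  obtain ⟨h, hh⟩ := Module.Dual.exists_forall_ne_zero_of_forall_exists
    (fun α : {α : LieModule.Weight K A L // α.IsNonZero} => α.1.toLinear) fun α => by
      by_contra! hcon
      exact α.2 (funext hcon)
  refine ⟨h, fun b => ?_⟩
  have key : b ∈ A.toSubmodule ⊔ LinearMap.range (LieModule.toEnd K A L h) := by
    have htop := congrArg LieSubmodule.toSubmodule (LieAlgebra.cartan_sup_iSup_rootSpace_eq_top A)
    simp only [LieSubmodule.sup_toSubmodule, LieSubmodule.iSup_toSubmodule] at htop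
    have hle := sup_le_sup (le_refl A.toLieSubmodule.toSubmodule)
      (iSup₂_le fun (α : LieModule.Weight K A L) (hα : α.IsNonZero) =>
        show (LieAlgebra.rootSpace A α).toSubmodule ≤
            LinearMap.range (LieModule.toEnd K A L h) from
          le_trans (LieModule.genWeightSpace_le_genWeightSpaceOf L h α)
            (Module.End.maxGenEigenspace_le_range _ (hh ⟨α, hα⟩)))
    rw [htop] at hle
    exact hle trivial
  obtain ⟨a, ha, _, ⟨x, rfl⟩, rfl⟩ := Submodule.mem_sup.1 key
  refine ⟨⟨a, ha⟩, -x, ?_⟩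
  rw [neg_lie, lie_skew]
  rfl

open scoped Topology in
/-- If `[S, h]` and `T` span `S`, then near `h` every element of `S` is conjugate to an element
of `T`. -/
theorem eventually_exists_units_conj_eq {𝔸 : Type*} [NormedRing 𝔸] [NormedAlgebra ℂ 𝔸]
    [FiniteDimensional ℂ 𝔸] (S T : Submodule ℂ 𝔸) (hTS : T ≤ S)
    (hS : ∀ x ∈ S, ∀ y ∈ S, x * y - y * x ∈ S) {h : 𝔸} (hh : h ∈ T)
    (hspan : ∀ b ∈ S, ∃ a ∈ T, ∃ x ∈ S, a + (x * h - h * x) = b) :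
    ∀ᶠ b in 𝓝[S] h, ∃ a ∈ T, ∃ u : 𝔸ˣ, u * a * ↑u⁻¹ = b := by
  let _ : NormedAlgebra ℚ 𝔸 := .restrictScalars ℚ ℂ 𝔸
  have : CompleteSpace 𝔸 := FiniteDimensional.complete ℂ 𝔸
  have : CompleteSpace S := FiniteDimensional.complete ℂ S
  have : CompleteSpace T := FiniteDimensional.complete ℂ T
  obtain ⟨p, hp⟩ := S.subtype.exists_leftInverse_of_injective S.ker_subtype
  let π : 𝔸 →L[ℂ] S := p.toContinuousLinearMap
  have hπ : ∀ b : S, π b = b := fun b => LinearMap.congr_fun hp b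
  let F : T × S → 𝔸 := fun z => NormedSpace.exp (z.2 : 𝔸) * z.1 * NormedSpace.exp (-(z.2 : 𝔸))
  let iT : T × S →L[ℂ] 𝔸 := T.subtypeL.comp (.fst ℂ T S)
  let iS : T × S →L[ℂ] 𝔸 := S.subtypeL.comp (.snd ℂ T S)
  let z₀ : T × S := (⟨h, hh⟩, 0)
  have hFS : ∀ z, F z ∈ S := fun z =>
    exp_mul_mul_exp_neg_mem S S.closed_of_finiteDimensional (hS _ z.2.2) (hTS z.1.2)
  have hexp : HasStrictFDerivAt (fun z : T × S => NormedSpace.exp (z.2 : 𝔸)) iS z₀ := by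
    have := (hasStrictFDerivAt_exp_zero (𝕂 := ℂ) (𝔸 := 𝔸))
    exact HasStrictFDerivAt.comp z₀ (f := iS) (by simpa [iS, z₀] using this) iS.hasStrictFDerivAt
  have hexp' : HasStrictFDerivAt (fun z : T × S => NormedSpace.exp (-(z.2 : 𝔸))) (-iS) z₀ := by
    have := (hasStrictFDerivAt_exp_zero (𝕂 := ℂ) (𝔸 := 𝔸))
    exact HasStrictFDerivAt.comp z₀ (f := (-iS : T × S →L[ℂ] 𝔸))
      (by simpa [iS, z₀] using this) (-iS).hasStrictFDerivAt
  have hF := (hexp.mul' (iT.hasStrictFDerivAt (x := z₀))).mul' hexp'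
  have hπF := π.hasStrictFDerivAt.comp z₀ hF
  -- The derivative at `(h, 0)` is `(a, x) ↦ a + (x * h - h * x)`. It is onto `S` only, hence the
  -- projection `π`.
  have hmap : Filter.map (π ∘ F) (𝓝 z₀) = 𝓝 ((π ∘ F) z₀) := hπF.map_nhds_eq_of_surj (by
    rw [LinearMap.range_eq_top]
    rintro ⟨b, hb⟩
    obtain ⟨a, ha, x, hx, rfl⟩ := hspan b hb
    refine ⟨(⟨a, ha⟩, ⟨x, hx⟩), ?_⟩
    rw [← hπ ⟨_, hb⟩]
    simp [iS, iT, z₀]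
    abel)
  have hπF₀ : (π ∘ F) z₀ = ⟨h, hTS hh⟩ := by
    rw [← hπ ⟨h, hTS hh⟩]
    simp [F, z₀]
  have hev : ∀ᶠ b : S in 𝓝 (⟨h, hTS hh⟩ : S),
      ∃ a ∈ T, ∃ u : 𝔸ˣ, u * a * ↑u⁻¹ = (b : 𝔸) := by
    rw [← hπF₀]
    change _ ∈ 𝓝 _
    rw [← hmap]
    refine Filter.mem_map.2 <| Filter.univ_mem' fun z => ⟨z.1, z.1.2,
      ⟨NormedSpace.exp (z.2 : 𝔸), NormedSpace.exp (-(z.2 : 𝔸)), ?_, ?_⟩, ?_⟩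
    · rw [← NormedSpace.exp_add_of_commute (Commute.refl _).neg_right]
      simp
    · rw [← NormedSpace.exp_add_of_commute (Commute.refl _).neg_left]
      simp
    exact congrArg Subtype.val (hπ ⟨F z, hFS z⟩).symm
  rw [nhdsWithin_eq_map_subtype_coe (hTS hh)]
  exact hev

theorem mrk_mono {𝕜 : Type*} [Field 𝕜] {n : ℕ} {V W : Submodule 𝕜 (Matrix (Fin n) (Fin n) 𝕜)}
    (h : V ≤ W) : mrk V ≤ mrk W := by
  obtain ⟨M, hM, hr⟩ := (mrk_isGreatest V).1
  exact (mrk_isGreatest W).2 ⟨M, h hM, hr⟩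

theorem Matrix.rank_units_conj {K : Type*} [Field K] {n : Type*} [Fintype n] [DecidableEq n]
    (u : (Matrix n n K)ˣ) (a : Matrix n n K) :
    ((u : Matrix n n K) * a * (↑u⁻¹ : Matrix n n K)).rank = a.rank := by
  rw [Matrix.rank_mul_eq_left_of_isUnit_det _ _ ((Matrix.isUnit_iff_isUnit_det _).1 u⁻¹.isUnit),
    Matrix.rank_mul_eq_right_of_isUnit_det _ _ ((Matrix.isUnit_iff_isUnit_det _).1 u.isUnit)]

open scoped Matrix.Norms.Operator Topology in
theorem mainTheorem5 (n : ℕ) (B : LieSubalgebra ℂ (Matrix (Fin n) (Fin n) ℂ))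
    (A : LieSubalgebra ℂ B) (hA : A.IsCartanSubalgebra) :
    mrk B.toSubmodule = mrk (A.map B.incl).toSubmodule := by
  have hAB : (A.map B.incl).toSubmodule ≤ B.toSubmodule := by
    rintro _ ⟨a, -, rfl⟩
    exact a.2
  refine le_antisymm ?_ (mrk_mono hAB)
  obtain ⟨h, hh⟩ := LieSubalgebra.IsCartanSubalgebra.exists_forall_eq_add_lie A
  have hmem : ((h : B) : Matrix (Fin n) (Fin n) ℂ) ∈ (A.map B.incl).toSubmodule := ⟨h, h.2, rfl⟩
  have hev := eventually_exists_units_conj_eq B.toSubmodule (A.map B.incl).toSubmodule hAB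
    (fun x hx y hy => B.lie_mem hx hy) hmem (fun b hb => by
      obtain ⟨a, x, hax⟩ := hh ⟨b, hb⟩
      exact ⟨_, ⟨a, a.2, rfl⟩, x, x.2, congrArg Subtype.val hax⟩)
  obtain ⟨M, hM, hr⟩ := (mrk_isGreatest B.toSubmodule).1
  let γ : ℂ → Matrix (Fin n) (Fin n) ℂ := fun t => (h : B) + t • (M - (h : B))
  have hγ : Filter.Tendsto γ (𝓝[≠] 0) (𝓝[B.toSubmodule] ((h : B) : Matrix (Fin n) (Fin n) ℂ)) := by
    refine tendsto_nhdsWithin_iff.2 ⟨?_, Filter.Eventually.of_forall fun t =>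
      B.add_mem (h : B).2 (B.smul_mem t (B.sub_mem hM (h : B).2))⟩
    have hcont : Continuous γ := by fun_prop
    simpa [γ] using (hcont.tendsto 0).mono_left nhdsWithin_le_nhds
  have hfin := Matrix.finite_rank_lineMap_lt ((h : B) : Matrix (Fin n) (Fin n) ℂ) M
  have hrank : ∀ᶠ t in 𝓝[≠] (0 : ℂ), M.rank ≤ (γ t).rank := by
    -- The point `0` is removed from the exceptional set, since `h` itself may have smaller rank.
    have hnhds := (hfin.sdiff (t := {0})).isClosed.isOpen_compl.mem_nhds (x := 0) (by simp)
    filter_upwards [nhdsWithin_le_nhds hnhds, self_mem_nhdsWithin] with t ht ht0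
    by_contra! hlt
    exact ht ⟨hlt, ht0⟩
  obtain ⟨t, ⟨a, ha, x, hx⟩, ht⟩ := ((hγ.eventually hev).and hrank).exists
  rw [← hr]
  refine ht.trans ?_
  rw [← hx, Matrix.rank_units_conj]
  exact (mrk_isGreatest _).2 ⟨a, ha, rfl⟩
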